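/- Let $E$ be a separable metrizable space and let $d$ be a complete metric on $E$ generating its topology (so $E$ is a Polish space). Let $X=(X(t))_{t\in\mathbb R}$ be an $E$-valued stochastic process with continuous trajectories, defined on a probability space $(\Omega,\mathcal F,P)$. Assume that for every compact interval $[a,b]\subset\mathbb R$ and all $\varepsilon>0$, $\eta>0$ there exists $\delta>0$ such that, for every $r\in\mathbb R$, $$P\Bigl\{\sup_{s,t\in[a,b],\ |t-s|<\delta} d\bigl(X(r+t),X(r+s)\bigr)>\eta\Bigr\}<\varepsilon .$$ For a topological space $Y$, call a continuous map $f:\mathbb R\to Y$ almost automorphic if every real sequence $(t'_n)$ has a subsequence $(t_n)$ for which there is a function $g:\mathbb R\to Y$ (not necessarily continuous) with $f(t+t_n)\to g(t)$ and $g(t-t_n)\to f(t)$ as $n\to\infty$, for every $t\in\mathbb R$. Let $\mathcal P(Y)$ denote the set of Borel probability measures on $Y$ with the topology of narrow (weak) convergence, and let $C_k(\mathbb R,E)$ be the space of continuous functions $\mathbb R\to E$ with the topology of uniform convergence on compact sets. Then the following are equivalent: (a) $X$ is almost automorphic in finite-dimensional distributions: for every finite sequence $t_1,\dots,t_m\in\mathbb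 R$, the map $t\mapsto \mathrm{law}\bigl(X(t+t_1),\dots,X(t+t_m)\bigr)$, $\mathbb R\to\mathcal P(E^m)$, is almost automorphic; (b) $X$ is almost automorphic in distribution: the map $t\mapsto \mathrm{law}\bigl(X(t+\cdot)\bigr)$, $\mathbb R\to\mathcal P(C_k(\mathbb R,E))$, is almost automorphic. -/

import Mathlib

open MeasureTheory Filter Topology Set

noncomputable section

namespace AlmostAutomorphy

/-- A map `f : ℝ → Y` into a topological space is almost automorphic if it is continuous and every
real sequence `t'` has a subsequence `t = t' ∘ φ` such that, for some function `g`,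
`f (t + t_n) → g t` and `g (t - t_n) → f t` for every `t`. The limit `g` need not be continuous. -/
def IsAlmostAutomorphic {Y : Type*} [TopologicalSpace Y] (f : ℝ → Y) : Prop :=
  Continuous f ∧
    ∀ t' : ℕ → ℝ, ∃ φ : ℕ → ℕ, StrictMono φ ∧ ∃ g : ℝ → Y,
      (∀ t : ℝ, Tendsto (fun n => f (t + t' (φ n))) atTop (𝓝 (g t))) ∧
      (∀ t : ℝ, Tendsto (fun n => g (t - t' (φ n))) atTop (𝓝 (f t)))

/-- The Borel σ-algebra of `C(ℝ, E)`, which carries the compact-open topology, that is, the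
topology of uniform convergence on compact sets. -/
instance instMeasurableSpacePath (E : Type*) [TopologicalSpace E] :
    MeasurableSpace C(ℝ, E) := borel _

instance instBorelSpacePath (E : Type*) [TopologicalSpace E] : BorelSpace C(ℝ, E) := ⟨rfl⟩

/-- An `E`-valued stochastic process indexed by `ℝ` with continuous trajectories. -/
structure ContinuousProcess (Ω E : Type*) [MeasurableSpace Ω] [TopologicalSpace E]
    [MeasurableSpace E] where
  /-- the underlying family of random variables -/
  val : ℝ → Ω → E
  measurable_val : ∀ t, Measurable (val t)
  continuous_path : ∀ ω, Continuous fun t => val t ω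

/-- The law of a random variable, as a point of the space of Borel probability measures with the
topology of narrow convergence. -/
def law {Ω F : Type*} [MeasurableSpace Ω] [MeasurableSpace F] (P : Measure Ω)
    [IsProbabilityMeasure P] (U : Ω → F) (hU : Measurable U) : ProbabilityMeasure F :=
  ⟨P.map U, Measure.isProbabilityMeasure_map hU.aemeasurable⟩

/-- A map into the path space is measurable as soon as its evaluations are. -/
theorem measurable_of_eval {Ω E : Type*} [MeasurableSpace Ω] [TopologicalSpace E]
    [TopologicalSpace.PseudoMetrizableSpace E] [SecondCountableTopology E]
    [MeasurableSpace E] [BorelSpace E] (F : Ω → C(ℝ, E))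
    (hF : ∀ t, Measurable fun ω => F ω t) : Measurable F := by
  let := TopologicalSpace.pseudoMetrizableSpacePseudoMetric E
  have hb : borel C(ℝ, E) = MeasurableSpace.generateFrom
      (image2 (fun K U => {f : C(ℝ, E) | MapsTo f K U}) {K | IsCompact K} {U | IsOpen U}) :=
    borel_eq_generateFrom_of_subbasis rfl
  change @Measurable Ω C(ℝ, E) _ (borel _) F
  rw [hb]
  refine measurable_generateFrom ?_
  rintro _ ⟨K, hK, U, hU, rfl⟩
  obtain ⟨D, hDK, hDc, hD⟩ := (TopologicalSpace.IsSeparable.of_separableSpace K).exists_countable_dense_subset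
  have key : F ⁻¹' {f : C(ℝ, E) | MapsTo f K U} =
      ⋃ n : ℕ, ⋂ t ∈ D, {ω | F ω t ∈ (Metric.thickening (1 / ((n : ℝ) + 1)) Uᶜ)ᶜ} := by
    ext ω
    simp only [mem_preimage, mem_setOf_eq, mem_iUnion, mem_iInter]
    constructor
    · intro h
      have hc : IsCompact (F ω '' K) := IsCompact.image hK (F ω).continuous
      have hd : Disjoint (F ω '' K) Uᶜ := by
        rw [disjoint_compl_right_iff_subset]
        exact h.image_subset
      obtain ⟨δ, hδ, hdis⟩ := hd.exists_thickenings hc (IsOpen.isClosed_compl hU)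
      obtain ⟨n, hn⟩ := exists_nat_one_div_lt hδ
      refine ⟨n, fun t ht hmem => ?_⟩
      exact disjoint_left.1 hdis
        (Metric.self_subset_thickening hδ _ (mem_image_of_mem _ (hDK ht)))
        (Metric.thickening_mono hn.le _ hmem)
    · rintro ⟨n, hn⟩ t ht
      have hcl : IsClosed ((F ω) ⁻¹' (Metric.thickening (1 / ((n : ℝ) + 1)) Uᶜ)ᶜ) :=
        (Metric.isOpen_thickening.isClosed_compl).preimage (F ω).continuous
      have hsub : K ⊆ (F ω) ⁻¹' (Metric.thickening (1 / ((n : ℝ) + 1)) Uᶜ)ᶜ :=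
        hD.trans (closure_minimal (fun t ht => hn t ht) hcl)
      by_contra hU'
      exact hsub ht (Metric.self_subset_thickening (by positivity) _ hU')
  rw [key]
  exact MeasurableSet.iUnion fun n => MeasurableSet.biInter hDc fun t _ =>
    hF t (Metric.isOpen_thickening.isClosed_compl).measurableSet

namespace ContinuousProcess

variable {Ω E : Type*} [MeasurableSpace Ω] [TopologicalSpace E] [MeasurableSpace E]

/-- The translate `X(t + ·)`, a random element of `C(ℝ, E)`. -/
def translate (X : ContinuousProcess Ω E) (t : ℝ) (ω : Ω) : C(ℝ, E) :=
  ⟨fun s => X.val (t + s) ω, (X.continuous_path ω).comp (continuous_const_add t)⟩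

theorem measurable_translate [TopologicalSpace.PseudoMetrizableSpace E]
    [SecondCountableTopology E] [BorelSpace E] (X : ContinuousProcess Ω E) (t : ℝ) :
    Measurable (X.translate t) :=
  measurable_of_eval _ fun s => X.measurable_val (t + s)

/-- The random vector `(X(t + t_1), …, X(t + t_m))`. -/
def sample (X : ContinuousProcess Ω E) {m : ℕ} (τ : Fin m → ℝ) (t : ℝ) (ω : Ω) : Fin m → E :=
  fun i => X.val (t + τ i) ω

theorem measurable_sample (X : ContinuousProcess Ω E) {m : ℕ} (τ : Fin m → ℝ) (t : ℝ) :
    Measurable (X.sample τ t) :=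
  measurable_pi_lambda _ fun i => X.measurable_val (t + τ i)

/-- Almost automorphy in finite dimensional distributions. -/
def IsAAFiniteDim [SecondCountableTopology E] [BorelSpace E] (X : ContinuousProcess Ω E)
    (P : Measure Ω) [IsProbabilityMeasure P] : Prop :=
  ∀ (m : ℕ) (τ : Fin m → ℝ),
    IsAlmostAutomorphic fun t : ℝ => law P (X.sample τ t) (X.measurable_sample τ t)

/-- Almost automorphy in distribution. -/
def IsAADistribution [TopologicalSpace.PseudoMetrizableSpace E] [SecondCountableTopology E]
    [BorelSpace E] (X : ContinuousProcess Ω E) (P : Measure Ω) [IsProbabilityMeasure P] : Prop :=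
  IsAlmostAutomorphic fun t : ℝ => law P (X.translate t) (X.measurable_translate t)

end ContinuousProcess

/-- The tightness condition: a modulus of continuity in probability on each compact interval,
uniform with respect to all shifts `r`. The supremum is taken in `[0, ∞]`. -/
def ContinuousProcess.ShiftUniformModulus {Ω E : Type*} [MeasurableSpace Ω] [MetricSpace E]
    [MeasurableSpace E] (X : ContinuousProcess Ω E) (P : Measure Ω) : Prop :=
  ∀ a b : ℝ, a ≤ b → ∀ ε : ℝ, 0 < ε → ∀ η : ℝ, 0 < η → ∃ δ : ℝ, 0 < δ ∧ ∀ r : ℝ,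
    P {ω | ENNReal.ofReal η <
      ⨆ (t ∈ Icc a b) (s ∈ Icc a b) (_ : |t - s| < δ),
        edist (X.val (r + t) ω) (X.val (r + s) ω)} < ENNReal.ofReal ε

end AlmostAutomorphy

end

open MeasureTheory Filter Topology Set

noncomputable section

namespace AlmostAutomorphy

/-! ### Almost automorphic maps -/

section General

variable {Y : Type*} [TopologicalSpace Y]

/-! Marginals depend continuously on the path law, so (b) gives (a). For the converse, the marginals
at finite sets of rational times are countably many continuous maps that jointly separate laws on
the path space, so on a compact set of laws they determine convergence. It is therefore enough that
the laws of all translates lie in one compact set (`isCompact_closure_range_law_translate`). Almost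
automorphy makes the one-dimensional laws uniformly tight, and the modulus condition upgrades this
to tightness of the path laws by Arzelà–Ascoli. A diagonal subsequence then serves all marginals at
once (`isAlmostAutomorphic_of_countable_family`). -/

theorem IsAlmostAutomorphic.continuous_comp {Z : Type*} [TopologicalSpace Z] {f : ℝ → Y}
    (hf : IsAlmostAutomorphic f) {h : Y → Z} (hh : Continuous h) :
    IsAlmostAutomorphic fun t => h (f t) := by
  refine ⟨hh.comp hf.1, fun t' => ?_⟩
  obtain ⟨φ, hφ, g, h1, h2⟩ := hf.2 t'
  exact ⟨φ, hφ, fun t => h (g t), fun t => (hh.tendsto _).comp (h1 t),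
    fun t => (hh.tendsto _).comp (h2 t)⟩

/-- Only the forward limit at time `0` matters: it makes some subsequence of `f (t n)` converge, and
points of the closure are approximated by such values. -/
theorem IsAlmostAutomorphic.isCompact_closure_range [TopologicalSpace.MetrizableSpace Y]
    {f : ℝ → Y} (hf : IsAlmostAutomorphic f) : IsCompact (closure (range f)) := by
  let := TopologicalSpace.metrizableSpaceMetric Y
  rw [isCompact_iff_isSeqCompact]
  intro y hy
  have hx : ∀ n : ℕ, ∃ t : ℝ, dist (y n) (f t) < 1 / ((n : ℝ) + 1) := fun n => by
    obtain ⟨_, ⟨t, rfl⟩, ht⟩ := Metric.mem_closure_iff.1 (hy n) _ (Nat.one_div_pos_of_nat (n := n))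
    exact ⟨t, ht⟩
  choose t ht using hx
  obtain ⟨φ, hφ, g, hg, -⟩ := hf.2 t
  have hg0 : Tendsto (fun n => f (t (φ n))) atTop (𝓝 (g 0)) := by simpa using hg 0
  refine ⟨g 0, mem_closure_of_tendsto hg0 (Eventually.of_forall fun n => mem_range_self _),
    φ, hφ, ?_⟩
  refine hg0.congr_dist ?_
  refine squeeze_zero (fun _ => dist_nonneg) (fun n => ?_)
    (tendsto_one_div_add_atTop_nhds_zero_nat.comp hφ.tendsto_atTop)
  rw [dist_comm]
  exact (ht (φ n)).le

/-- Diagonal extraction for countably many properties of subsequences. -/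
theorem exists_strictMono_forall_of_subseq {p : ℕ → (ℕ → ℕ) → Prop}
    (hex : ∀ i φ, StrictMono φ → ∃ θ : ℕ → ℕ, StrictMono θ ∧ p i (φ ∘ θ))
    (hsub : ∀ i φ (θ : ℕ → ℕ) ψ, p i φ → Tendsto θ atTop atTop → ψ =ᶠ[atTop] φ ∘ θ → p i ψ) :
    ∃ φ : ℕ → ℕ, StrictMono φ ∧ ∀ i, p i φ := by
  choose θ hθ hp using hex
  let Φ : ℕ → {φ : ℕ → ℕ // StrictMono φ} := fun n => Nat.rec ⟨id, strictMono_id⟩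
    (fun i φ => ⟨φ.1 ∘ θ i φ.1 φ.2, φ.2.comp (hθ i φ.1 φ.2)⟩) n
  have hΦ : ∀ n, (Φ (n + 1)).1 = (Φ n).1 ∘ θ n (Φ n).1 (Φ n).2 := fun n => rfl
  have hfac : ∀ i k, ∃ Θ : ℕ → ℕ, StrictMono Θ ∧ (Φ (i + k)).1 = (Φ i).1 ∘ Θ := by
    intro i k
    induction k with
    | zero => exact ⟨id, strictMono_id, rfl⟩
    | succ k ih =>
      obtain ⟨Θ, h1, h2⟩ := ih
      refine ⟨Θ ∘ θ (i + k) _ (Φ (i + k)).2, h1.comp (hθ _ _ _), ?_⟩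
      exact congrArg (· ∘ θ (i + k) _ (Φ (i + k)).2) h2
  choose Θ hΘ hΦΘ using hfac
  refine ⟨fun n => (Φ n).1 n, strictMono_nat_of_lt_succ fun n => ?_, fun i => ?_⟩
  · simp only [hΦ, Function.comp_apply]
    exact (Φ n).2 (n.lt_succ_self.trans_le ((hθ n _ _).le_apply))
  -- Stage `i + 1` is the first to satisfy `p i`. The diagonal factors through it only from index `i
  -- + 1` on; below that, truncated subtraction gives a harmless value.
  · refine hsub i (Φ (i + 1)).1 (fun n => Θ (i + 1) (n - (i + 1)) n) _ (hp i _ _) ?_ ?_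
    · exact tendsto_atTop_mono (fun n => (hΘ _ _).le_apply) tendsto_id
    · filter_upwards [eventually_ge_atTop (i + 1)] with n hn
      have h := congrFun (hΦΘ (i + 1) (n - (i + 1))) n
      rwa [Nat.add_sub_cancel' hn] at h

/-- On a compact set, a jointly injective family of continuous maps determines convergence. -/
theorem tendsto_of_forall_tendsto_comp {ι α : Type*} {Z : ι → Type*}
    [∀ i, TopologicalSpace (Z i)] [∀ i, T2Space (Z i)] {K : Set Y} (hK : IsCompact K)
    {π : ∀ i, Y → Z i} (hπ : ∀ i, Continuous (π i))
    (hinj : ∀ x y, (∀ i, π i x = π i y) → x = y) {l : Filter α} {u : α → Y} {y : Y}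
    (hu : ∀ a, u a ∈ K) (hy : y ∈ K) (h : ∀ i, Tendsto (fun a => π i (u a)) l (𝓝 (π i y))) :
    Tendsto u l (𝓝 y) := by
  have := isCompact_iff_compactSpace.1 hK
  have hc : Continuous fun x : K => fun i => π i x :=
    continuous_pi fun i => (hπ i).comp continuous_subtype_val
  have he := hc.isClosedEmbedding fun x y hxy => Subtype.ext (hinj _ _ fun i => congrFun hxy i)
  have hK' : Tendsto (fun a => (⟨u a, hu a⟩ : K)) l (𝓝 ⟨y, hy⟩) :=
    he.isInducing.tendsto_nhds_iff.2 (tendsto_pi_nhds.2 h)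
  exact (continuous_subtype_val.tendsto _).comp hK'

theorem isAlmostAutomorphic_of_countable_family {ι : Type*} [Countable ι] {Z : ι → Type*}
    [∀ i, TopologicalSpace (Z i)] [∀ i, T2Space (Z i)] {f : ℝ → Y}
    (hK : IsCompact (closure (range f)))
    {π : ∀ i, Y → Z i} (hπ : ∀ i, Continuous (π i))
    (hinj : ∀ x y, (∀ i, π i x = π i y) → x = y)
    (hf : ∀ i, IsAlmostAutomorphic fun t => π i (f t)) : IsAlmostAutomorphic f := by
  have hfK : ∀ t, f t ∈ closure (range f) := fun t => subset_closure (mem_range_self t)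
  refine ⟨continuous_iff_continuousAt.2 fun t => tendsto_of_forall_tendsto_comp hK hπ hinj hfK
    (hfK t) fun i => (hf i).1.tendsto t, fun t' => ?_⟩
  obtain ⟨φ, hφ, hp⟩ : ∃ φ : ℕ → ℕ, StrictMono φ ∧ ∀ i, ∃ g : ℝ → Z i,
      (∀ t : ℝ, Tendsto (fun n => π i (f (t + t' (φ n)))) atTop (𝓝 (g t))) ∧
      (∀ t : ℝ, Tendsto (fun n => g (t - t' (φ n))) atTop (𝓝 (π i (f t)))) := by
    rcases isEmpty_or_nonempty ι with hι | hι
    · exact ⟨id, strictMono_id, fun i => hι.elim i⟩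
    obtain ⟨e, he⟩ := exists_surjective_nat ι
    obtain ⟨φ, hφ, hp⟩ := exists_strictMono_forall_of_subseq
      (p := fun k φ => ∃ g : ℝ → Z (e k),
        (∀ t : ℝ, Tendsto (fun n => π (e k) (f (t + t' (φ n)))) atTop (𝓝 (g t))) ∧
        (∀ t : ℝ, Tendsto (fun n => g (t - t' (φ n))) atTop (𝓝 (π (e k) (f t)))))
      (fun k φ _ => by
        obtain ⟨θ, hθ, g, h⟩ := (hf (e k)).2 (t' ∘ φ)
        exact ⟨θ, hθ, g, h⟩)
      (by
        rintro k φ θ ψ ⟨g, h1, h2⟩ hθ hψ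
        refine ⟨g, fun t => ((h1 t).comp hθ).congr' ?_, fun t => ((h2 t).comp hθ).congr' ?_⟩ <;>
        · filter_upwards [hψ] with n hn
          simp [hn])
    refine ⟨φ, hφ, fun i => ?_⟩
    obtain ⟨k, rfl⟩ := he i
    exact hp k
  choose g hg1 hg2 using hp
  have hc : Continuous fun y => fun i => π i y := continuous_pi hπ
  -- The limits found separately in each coordinate come from a single point, because the compact
  -- image of the closure is closed in the Hausdorff product.
  have hG : ∀ t, ∃ y ∈ closure (range f), (fun i => π i y) = fun i => g i t := fun t =>
    (hK.image hc).isClosed.mem_of_tendsto (tendsto_pi_nhds.2 fun i => hg1 i t)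
      (Eventually.of_forall fun n => mem_image_of_mem _ (hfK _))
  choose G hGK hG using hG
  refine ⟨φ, hφ, G, fun t => ?_, fun t => ?_⟩
  · refine tendsto_of_forall_tendsto_comp hK hπ hinj (fun _ => hfK _) (hGK t) fun i => ?_
    rw [congrFun (hG t) i]
    exact hg1 i t
  · refine tendsto_of_forall_tendsto_comp hK hπ hinj (fun _ => hGK _) (hfK t) fun i => ?_
    simp only [fun s => congrFun (hG s) i]
    exact hg2 i t

end General

/-! ### Compactness and finite-dimensional marginals in the path space -/

section Path

variable {E : Type*} [MetricSpace E]

/-- Arzelà–Ascoli. Control at rational times suffices: equicontinuity carries total boundedness from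
a nearby rational to any time, and completeness turns it into relative compactness. -/
theorem isCompact_closure_of_rational_values_of_modulus [CompleteSpace E] {K : ℚ → Set E}
    (hK : ∀ q, IsCompact (K q)) {δ : ℕ → ℝ} (hδ : ∀ n, 0 < δ n) :
    IsCompact (closure {f : C(ℝ, E) | (∀ q : ℚ, f q ∈ K q) ∧ ∀ n : ℕ,
      ∀ t ∈ Icc (-n : ℝ) n, ∀ s ∈ Icc (-n : ℝ) n, |t - s| < δ n →
        dist (f t) (f s) ≤ 1 / ((n : ℝ) + 1)}) := by
  set S := {f : C(ℝ, E) | (∀ q : ℚ, f q ∈ K q) ∧ ∀ n : ℕ,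
      ∀ t ∈ Icc (-n : ℝ) n, ∀ s ∈ Icc (-n : ℝ) n, |t - s| < δ n →
        dist (f t) (f s) ≤ 1 / ((n : ℝ) + 1)} with hS
  have hmod : ∀ (x ε : ℝ), 0 < ε → ∃ ρ > 0, ∀ y, |x - y| < ρ → ∀ f ∈ S,
      dist (f x) (f y) < ε := by
    intro x ε hε
    obtain ⟨n₁, hn₁⟩ := exists_nat_one_div_lt hε
    obtain ⟨n₂, hn₂⟩ := exists_nat_gt (|x| + 1)
    have hle : 1 / (((max n₁ n₂ : ℕ) : ℝ) + 1) ≤ 1 / ((n₁ : ℝ) + 1) :=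
      Nat.one_div_le_one_div (le_max_left _ _)
    have hn : |x| + 1 < (max n₁ n₂ : ℕ) := hn₂.trans_le (by exact_mod_cast le_max_right _ _)
    -- `n₁` gives the accuracy; `n₂` and the bound `1` keep both `x` and `y` inside the window.
    refine ⟨min 1 (δ (max n₁ n₂)), lt_min one_pos (hδ _), fun y hy f hf => ?_⟩
    refine ((hf.2 (max n₁ n₂) x ?_ y ?_ (hy.trans_le (min_le_right _ _))).trans hle).trans_lt hn₁
    · exact abs_le.1 (by linarith)
    · refine abs_le.1 ?_
      have h1 := hy.trans_le (min_le_left _ _)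
      have h2 := abs_sub_abs_le_abs_sub y x
      rw [abs_sub_comm] at h2
      linarith
  refine ArzelaAscoli.isCompact_closure_of_isClosedEmbedding (F := fun f : C(ℝ, E) => (f : ℝ → E))
    (𝔖 := {K : Set ℝ | IsCompact K}) (fun _ h => h)
    ?_ ?_ ?_
  · have : T2Space (UniformOnFun ℝ E {K | IsCompact K}) :=
      UniformOnFun.t2Space_of_covering
        (eq_univ_iff_forall.2 fun x => mem_sUnion_of_mem (mem_singleton x) isCompact_singleton)
    exact ContinuousMap.isUniformEmbedding_toUniformOnFunIsCompact.isClosedEmbedding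
  · refine fun L _ => Equicontinuous.equicontinuousOn (fun x => ?_) L
    rw [Metric.equicontinuousAt_iff]
    intro ε hε
    obtain ⟨ρ, hρ, h⟩ := hmod x ε hε
    refine ⟨ρ, hρ, fun y hy f => h y ?_ f f.2⟩
    rwa [dist_comm, Real.dist_eq] at hy
  · intro L _ x _
    have htb : TotallyBounded ((fun f : C(ℝ, E) => f x) '' S) := by
      rw [Metric.totallyBounded_iff]
      intro ε hε
      obtain ⟨ρ, hρ, h⟩ := hmod x (ε / 2) (half_pos hε)
      obtain ⟨q, hq1, hq2⟩ := exists_rat_btwn (show x < x + ρ by linarith)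
      obtain ⟨c, hc, hcK⟩ := Metric.totallyBounded_iff.1 (hK q).totallyBounded _ (half_pos hε)
      refine ⟨c, hc, ?_⟩
      rintro _ ⟨f, hf, rfl⟩
      obtain ⟨z, hz, hfz⟩ := mem_iUnion₂.1 (hcK (hf.1 q))
      refine mem_iUnion₂.2 ⟨z, hz, ?_⟩
      have h1 := h q (abs_lt.2 ⟨by linarith, by linarith⟩) f hf
      have h2 := Metric.mem_ball.1 hfz
      exact (dist_triangle _ (f q) _).trans_lt (by linarith)
    exact ⟨_, htb.closure.isCompact_of_isClosed isClosed_closure,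
      fun f hf => subset_closure (mem_image_of_mem _ hf)⟩

/-- Evaluation of a path at finitely many times. -/
def evalTuple {m : ℕ} (τ : Fin m → ℝ) (f : C(ℝ, E)) : Fin m → E := fun i => f (τ i)

theorem continuous_evalTuple {m : ℕ} (τ : Fin m → ℝ) :
    Continuous (evalTuple (E := E) τ) :=
  continuous_pi fun i => continuous_eval_const (τ i)

variable [SecondCountableTopology E] [MeasurableSpace E] [BorelSpace E]

/-- The finite-dimensional marginal of a probability measure on the path space. -/
def marginal {m : ℕ} (τ : Fin m → ℝ) (μ : ProbabilityMeasure C(ℝ, E)) :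
    ProbabilityMeasure (Fin m → E) :=
  μ.map (continuous_evalTuple τ).measurable.aemeasurable

theorem continuous_marginal {m : ℕ} (τ : Fin m → ℝ) : Continuous (marginal (E := E) τ) :=
  ProbabilityMeasure.continuous_map (continuous_evalTuple τ)

/-- An enumeration of a finite set of rational times. -/
def rationalTimes (I : Finset ℚ) (k : Fin I.card) : ℝ := ((I.equivFin.symm k : ℚ) : ℝ)

/-- A law on the path space is determined by its marginals at rational times. -/
theorem eq_of_forall_marginal_rationalTimes_eq [CompleteSpace E]
    {μ ν : ProbabilityMeasure C(ℝ, E)}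
    (h : ∀ I : Finset ℚ, marginal (rationalTimes I) μ = marginal (rationalTimes I) ν) :
    μ = ν := by
  let r : C(ℝ, E) → ℚ → E := fun f q => f q
  have hr : Continuous r := continuous_pi fun q => continuous_eval_const _
  have hinj : Function.Injective r := fun f g hfg => DFunLike.coe_injective <|
    Rat.denseRange_cast.equalizer f.continuous g.continuous hfg
  -- Lusin–Souslin: a continuous injection of a Polish space is a measurable embedding, so a path
  -- law is recovered from its image on `ℚ → E`, which is fixed by its finite marginals.
  have hemb : MeasurableEmbedding r := hr.measurableEmbedding hinj
  have hI : ∀ (I : Finset ℚ) (ρ : ProbabilityMeasure C(ℝ, E)),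
      ((ρ : Measure C(ℝ, E)).map r).map I.restrict =
        (marginal (rationalTimes I) ρ : Measure (Fin I.card → E)).map
          fun x (i : I) => x (I.equivFin i) := by
    intro I ρ
    rw [marginal, ProbabilityMeasure.toMeasure_map,
      Measure.map_map (Finset.measurable_restrict I) hr.measurable,
      Measure.map_map (by fun_prop) (continuous_evalTuple _).measurable]
    congr 1
    ext f i
    simp [r, evalTuple, rationalTimes]
  have hmap : (μ : Measure C(ℝ, E)).map r = (ν : Measure C(ℝ, E)).map r := by
    have : IsProbabilityMeasure ((ν : Measure C(ℝ, E)).map r) :=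
      Measure.isProbabilityMeasure_map hr.measurable.aemeasurable
    refine IsProjectiveLimit.unique
      (P := fun I : Finset ℚ => ((ν : Measure C(ℝ, E)).map r).map I.restrict) (fun I => ?_)
      fun I => rfl
    rw [hI, h]
    exact (hI I ν).symm
  refine ProbabilityMeasure.toMeasure_injective ?_
  rw [← hemb.comap_map (μ : Measure C(ℝ, E)), hmap, hemb.comap_map]

end Path

/-! ### Processes -/

namespace ContinuousProcess

variable {Ω E : Type*} [MeasurableSpace Ω] [MetricSpace E]
  [SecondCountableTopology E] [MeasurableSpace E] [BorelSpace E]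
  {P : Measure Ω} [IsProbabilityMeasure P] {X : ContinuousProcess Ω E}

theorem marginal_law_translate {m : ℕ} (τ : Fin m → ℝ) (t : ℝ) :
    marginal τ (law P (X.translate t) (X.measurable_translate t)) =
      law P (X.sample τ t) (X.measurable_sample τ t) := by
  refine ProbabilityMeasure.toMeasure_injective ?_
  exact Measure.map_map (continuous_evalTuple τ).measurable (X.measurable_translate t)

/-- The one-dimensional laws of a process almost automorphic in finite-dimensional distributions
are uniformly tight. -/
theorem IsAAFiniteDim.exists_isCompact_measure_le [CompleteSpace E] (hX : X.IsAAFiniteDim P)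
    {ε : ENNReal} (hε : 0 < ε) :
    ∃ K : Set E, IsCompact K ∧ ∀ t, P {ω | X.val t ω ∉ K} ≤ ε := by
  -- Converse half of Prokhorov's theorem, applied to the laws of `X t`.
  have ht := isTightMeasureSet_of_isCompact_closure
    (hX 1 fun _ => 0).isCompact_closure_range
  obtain ⟨K, hK, h⟩ := isTightMeasureSet_iff_exists_isCompact_measure_compl_le.1 ht ε hε
  refine ⟨(fun x => x 0) '' K, hK.image (continuous_apply 0), fun t => ?_⟩
  refine le_trans (measure_mono ?_) ((Measure.le_map_apply
    (X.measurable_sample (fun _ => 0) t).aemeasurable Kᶜ).trans (h _ ⟨_, mem_range_self t, rfl⟩))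
  intro ω hω hmem
  exact hω ⟨_, hmem, by simp [sample]⟩

/-- Direct half of Prokhorov's theorem. Half of `ε` is spread over the rational times for leaving `K
q`, half over the windows `[-n, n]` for violating the modulus; both bounds are uniform in the shift
`r`. -/
theorem IsAAFiniteDim.isCompact_closure_range_law_translate [CompleteSpace E]
    (hfd : X.IsAAFiniteDim P) (hX : X.ShiftUniformModulus P) :
    IsCompact (closure (range fun t => law P (X.translate t) (X.measurable_translate t))) := by
  refine isCompact_closure_of_isTightMeasureSet ?_
  rw [isTightMeasureSet_iff_exists_isCompact_measure_compl_le]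
  intro ε hε
  obtain ⟨a, ha, hasum⟩ := ENNReal.exists_pos_sum_of_countable (ENNReal.half_pos hε.ne').ne' ℚ
  obtain ⟨b, hb, hbsum⟩ := ENNReal.exists_pos_sum_of_countable (ENNReal.half_pos hε.ne').ne' ℕ
  choose K hK hKP using fun q =>
    hfd.exists_isCompact_measure_le (ENNReal.coe_pos.2 (ha q))
  choose δ hδ hδP using fun n : ℕ => hX (-n) n
    (by have : (0 : ℝ) ≤ n := n.cast_nonneg
        linarith) (b n) (hb n) (1 / ((n : ℝ) + 1)) Nat.one_div_pos_of_nat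
  have hcomp := isCompact_closure_of_rational_values_of_modulus hK hδ
  refine ⟨_, hcomp, ?_⟩
  rintro _ ⟨_, ⟨r, rfl⟩, rfl⟩
  refine (Measure.map_apply (X.measurable_translate r)
    isClosed_closure.measurableSet.compl).trans_le ?_
  have hsub : X.translate r ⁻¹' (closure {f : C(ℝ, E) | (∀ q : ℚ, f q ∈ K q) ∧ ∀ n : ℕ,
      ∀ t ∈ Icc (-n : ℝ) n, ∀ s ∈ Icc (-n : ℝ) n, |t - s| < δ n →
        dist (f t) (f s) ≤ 1 / ((n : ℝ) + 1)})ᶜ ⊆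
      (⋃ q : ℚ, {ω | X.val (r + q) ω ∉ K q}) ∪
      ⋃ n : ℕ, {ω | ENNReal.ofReal (1 / ((n : ℝ) + 1)) <
        ⨆ (t ∈ Icc (-n : ℝ) n) (s ∈ Icc (-n : ℝ) n) (_ : |t - s| < δ n),
          edist (X.val (r + t) ω) (X.val (r + s) ω)} := by
    intro ω hω
    by_contra hcon
    simp only [mem_union, mem_iUnion, mem_ofPred_eq, not_or, not_exists, not_not, not_lt] at hcon
    refine hω (subset_closure ⟨hcon.1, fun n t ht s hs hts => ?_⟩)
    have h := (le_iSup₂_of_le t ht (le_iSup₂_of_le s hs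
      (le_iSup_of_le hts le_rfl))).trans (hcon.2 n)
    rw [edist_dist] at h
    exact (ENNReal.ofReal_le_ofReal_iff Nat.one_div_pos_of_nat.le).1 h
  calc _ ≤ _ := measure_mono hsub
    _ ≤ _ := measure_union_le _ _
    _ ≤ ε / 2 + ε / 2 := by
      refine add_le_add ?_ ?_
      · exact (measure_iUnion_le _).trans
          ((ENNReal.tsum_le_tsum fun q => hKP q _).trans hasum.le)
      · refine (measure_iUnion_le _).trans
          ((ENNReal.tsum_le_tsum fun n => ?_).trans hbsum.le)
        simpa using (hδP n r).le
    _ = ε := ENNReal.add_halves ε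

end ContinuousProcess

end AlmostAutomorphy

end

theorem theorem3p3 {Ω E : Type*} [MeasurableSpace Ω] [MetricSpace E] [CompleteSpace E]
    [SecondCountableTopology E] [MeasurableSpace E] [BorelSpace E]
    (P : MeasureTheory.Measure Ω) [MeasureTheory.IsProbabilityMeasure P]
    (X : AlmostAutomorphy.ContinuousProcess Ω E) (hX : X.ShiftUniformModulus P) :
    X.IsAAFiniteDim P ↔ X.IsAADistribution P := by
  constructor
  · intro h
    refine AlmostAutomorphy.isAlmostAutomorphic_of_countable_family
      (h.isCompact_closure_range_law_translate hX)
      (fun I : Finset ℚ => AlmostAutomorphy.continuous_marginal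
        (AlmostAutomorphy.rationalTimes I))
      (fun _ _ => AlmostAutomorphy.eq_of_forall_marginal_rationalTimes_eq) fun I => ?_
    simp only [AlmostAutomorphy.ContinuousProcess.marginal_law_translate]
    exact h _ _
  · intro h m τ
    have := h.continuous_comp (AlmostAutomorphy.continuous_marginal τ)
    simpa only [AlmostAutomorphy.ContinuousProcess.marginal_law_translate] using this
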